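/- **Theorem (Lower bound).** Let $L,K\ge 1$, let $f=(f_1,\dots,f_K):\mathbb{R}^L\to\mathbb{R}^K$ be a reward map and let $\delta\in(0,1)$. An instance is a mean vector $\nu\in\mathbb{R}^L$: querying micro-observable $i\in[L]$ returns an independent observation from $N(\nu_i,1)$, and $f_j(\nu)$ is the payoff of arm $j\in[K]$. A deterministic learner $A$ chooses in each round $t=1,2,\dots$ an index $I_t\in[L]$ as a measurable function of the past, observes $Y_t\sim N(\nu_{I_t},1)$, and then decides, as a measurable function of the history $(I_1,Y_1,\dots,I_t,Y_t)$, whether to stop; if so, $T=t$ and it returns an arm $J\in[K]$ ($T=\infty$ if it never stops). Let $\mathbb{P}_{\nu,A}$, $\mathbb{E}_{\nu,A}$ denote the induced probability and expectation. Let $\mathcal{S}$ be the set of all $\nu\in\mathbb{R}^L$ for which the arm of highest payoff $\operatorname{argmax}_j f_j(\nu)$ is unique. Assume that $A$ is admissible over $\mathcal{S}$ at risk $\delta$, i.e. for every $\nu\in\mathcal{S}$, $$\mathbb{P}_{\nu,A}\bigl(J\neq \operatorname{argmax}_j f_j(\nu)\bigr)\le\delta\quad\text{and}\quad \mathbb{P}_{\nu,A}(T<\infty)=1.$$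 Let $\mu\in\mathcal{S}$, number the arms so that arm $1$ is the best arm under $\mu$, and let $$D_\mu=\Bigl\{\Delta\in\mathbb{R}^L : f_1(\mu+\Delta)\le \max_{i>1} f_i(\mu+\Delta)\Bigr\}$$ be the set of significant departures from $\mu$. Assume that $f$ is nondegenerate at $\mu$ in the sense that ties can be broken by arbitrarily small perturbations: every $\Delta\in D_\mu$ is a limit of vectors $\Delta'$ such that $\mu+\Delta'\in\mathcal{S}$ and the best arm under $\mu+\Delta'$ is not arm $1$. Define $$\tau^*(\mu)=\min\Bigl\{\sum_{i=1}^L n(i)\;:\; n(1),\dots,n(L)\in[0,\infty),\ \inf_{\Delta\in D_\mu}\sum_{i=1}^L n(i)\Delta_i^2\ge 2\log\frac{1}{4\delta}\Bigr\},$$ where $\inf\emptyset=+\infty$, and $\tau^*(\mu)=+\infty$ if no allocation $n$ is feasible. Then the minimum is attained whenever some allocation is feasible, and $$\mathbb{E}_{\mu,A}[T]\ge\tau^*(\mu).$$ -/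

import Mathlib

open MeasureTheory ProbabilityTheory
open scoped ENNReal

namespace StructuredBAI

/-- One round of interaction: the index of the queried micro-observable and the observed value. -/
abbrev Obs (L : ℕ) : Type := Fin L × ℝ

/-- A history made of the first `n + 1` rounds (rounds are numbered from `0`). -/
abbrev Hist (L n : ℕ) : Type := (i : Finset.Iic n) → Obs L

/-- The sample space: infinite sequences of pairs (queried index, observation). -/
abbrev Path (L : ℕ) : Type := ℕ → Obs L

/-- A deterministic learner for `L` micro-observables and `K` arms. It queries `first` in the first
round. After each round, seeing the history `h` so far, it stops if `h ∈ stopSet n`, and then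
recommends `answer n h`; otherwise it queries `next n h` in the following round. -/
structure Learner (L K : ℕ) where
  first : Fin L
  next : (n : ℕ) → Hist L n → Fin L
  stopSet : (n : ℕ) → Set (Hist L n)
  answer : (n : ℕ) → Hist L n → Fin K
  measurable_next : ∀ n, Measurable (next n)
  measurableSet_stopSet : ∀ n, MeasurableSet (stopSet n)
  measurable_answer : ∀ n, Measurable (answer n)

namespace Learner

variable {L K : ℕ}

/-- The histories of `n + 1` rounds in which the learner has stopped in the last round or before. -/
def stopped (A : Learner L K) (n : ℕ) : Set (Hist L n) :=
  ⋃ (m : ℕ) (hm : m ≤ n), Preorder.frestrictLe₂ (π := fun _ : ℕ => Obs L) hm ⁻¹' A.stopSet m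

theorem measurableSet_stopped (A : Learner L K) (n : ℕ) : MeasurableSet (A.stopped n) := by
  refine MeasurableSet.iUnion fun m => MeasurableSet.iUnion fun hm => ?_
  exact Preorder.measurable_frestrictLe₂ hm (A.measurableSet_stopSet m)

end Learner

/-- Querying micro-observable `i` when the observations are normal with mean `ν i` and variance
one: the pair `(i, Y)` with `Y ∼ N(ν i, 1)`. -/
noncomputable def query {L : ℕ} (ν : Fin L → ℝ) : Kernel (Fin L) (Obs L) :=
  Kernel.ofFunOfCountable fun i => (Measure.dirac i).prod (gaussianReal (ν i) 1)

instance {L : ℕ} (ν : Fin L → ℝ) : IsMarkovKernel (query ν) :=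
  ⟨fun i => inferInstanceAs
    (IsProbabilityMeasure ((Measure.dirac i).prod (gaussianReal (ν i) 1)))⟩

open Classical in
/-- The law of the next round given the history of the first `n + 1` rounds. Once the learner has
stopped, the first micro-observable is chosen and the observation is zero. -/
noncomputable def Learner.step {L K : ℕ} [NeZero L] (A : Learner L K) (ν : Fin L → ℝ) (n : ℕ) :
    Kernel (Hist L n) (Obs L) :=
  Kernel.piecewise (A.measurableSet_stopped n)
    (Kernel.const (Hist L n) (Measure.dirac ((0 : Fin L), (0 : ℝ))))
    ((query ν).comap (A.next n) (A.measurable_next n))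

instance {L K : ℕ} [NeZero L] (A : Learner L K) (ν : Fin L → ℝ) (n : ℕ) :
    IsMarkovKernel (A.step ν n) := by
  unfold Learner.step
  infer_instance

/-- The distribution over infinite sequences induced by the interaction of the learner `A` with the
instance of unit-variance normal distributions with mean vector `ν`. -/
noncomputable def Learner.law {L K : ℕ} [NeZero L] (A : Learner L K) (ν : Fin L → ℝ) :
    Measure (Path L) :=
  Kernel.trajMeasure (X := fun _ => Obs L) (query ν A.first) (A.step ν)

/-- The stopping criterion holds on `ω` after the round numbered `n`, i.e. after `n + 1`
observations. The learner stops at the first such round. -/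
def Learner.StopsAt {L K : ℕ} (A : Learner L K) (ω : Path L) (n : ℕ) : Prop :=
  Preorder.frestrictLe (π := fun _ : ℕ => Obs L) n ω ∈ A.stopSet n

open Classical in
/-- The number `T` of observations made until the learner stops; `⊤` if it never stops. -/
noncomputable def Learner.T {L K : ℕ} (A : Learner L K) (ω : Path L) : ℕ∞ :=
  if h : ∃ n, A.StopsAt ω n then ((Nat.find h + 1 : ℕ) : ℕ∞) else ⊤

open Classical in
/-- The recommended arm `J`; `none` if the learner never stops. -/
noncomputable def Learner.J {L K : ℕ} (A : Learner L K) (ω : Path L) : Option (Fin K) :=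
  if h : ∃ n, A.StopsAt ω n then
    some (A.answer (Nat.find h) (Preorder.frestrictLe (π := fun _ : ℕ => Obs L) (Nat.find h) ω))
  else none

/-- Arm `j` is the unique best arm under the mean vector `ν` for the reward map `f`. -/
def IsUniqueBest {L K : ℕ} (f : (Fin L → ℝ) → (Fin K → ℝ)) (ν : Fin L → ℝ) (j : Fin K) : Prop :=
  ∀ i, i ≠ j → f ν i < f ν j

/-- `A` is admissible at risk `δ` over all unit-variance normal instances with reward map `f` that
have a unique best arm: on each of them it misidentifies the best arm with probability at most `δ`
and stops with probability one. -/
def Admissible {L K : ℕ} [NeZero L] (f : (Fin L → ℝ) → (Fin K → ℝ)) (δ : ℝ)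
    (A : Learner L K) : Prop :=
  ∀ (ν : Fin L → ℝ) (j : Fin K), IsUniqueBest f ν j →
    A.law ν {ω | A.J ω ≠ some j} ≤ ENNReal.ofReal δ ∧ ∀ᵐ ω ∂(A.law ν), A.T ω < ⊤

/-- The significant departures from `μ`, where `k` is the best arm under `μ`: the vectors `Δ` with
`f_k (μ + Δ) ≤ max_{i ≠ k} f_i (μ + Δ)`. -/
def significantDepartures {L K : ℕ} (f : (Fin L → ℝ) → (Fin K → ℝ)) (μ : Fin L → ℝ)
    (k : Fin K) : Set (Fin L → ℝ) :=
  {Δ | ∃ i, i ≠ k ∧ f (μ + Δ) k ≤ f (μ + Δ) i}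

/-- The departures from `μ` that lead to an instance with a unique best arm different from `k`. -/
def changesBestArm {L K : ℕ} (f : (Fin L → ℝ) → (Fin K → ℝ)) (μ : Fin L → ℝ)
    (k : Fin K) : Set (Fin L → ℝ) :=
  {Δ | ∃ j, j ≠ k ∧ IsUniqueBest f (μ + Δ) j}

/-- The feasible (real, nonnegative) allocations. -/
def feasible {L K : ℕ} (f : (Fin L → ℝ) → (Fin K → ℝ)) (μ : Fin L → ℝ) (k : Fin K) (δ : ℝ) :
    Set (Fin L → ℝ) :=
  {n | (∀ i, 0 ≤ n i) ∧
    ∀ Δ ∈ significantDepartures f μ k, 2 * Real.log (1 / (4 * δ)) ≤ ∑ i, n i * Δ i ^ 2}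

/-- The total sizes of the feasible allocations. -/
def feasibleTotals {L K : ℕ} (f : (Fin L → ℝ) → (Fin K → ℝ)) (μ : Fin L → ℝ) (k : Fin K)
    (δ : ℝ) : Set ℝ≥0∞ :=
  {s | ∃ n ∈ feasible f μ k δ, s = ENNReal.ofReal (∑ i, n i)}

/-- The least total size of a feasible allocation, `∞` if there is no feasible allocation. -/
noncomputable def tauStar {L K : ℕ} (f : (Fin L → ℝ) → (Fin K → ℝ)) (μ : Fin L → ℝ) (k : Fin K)
    (δ : ℝ) : ℝ≥0∞ :=
  sInf (feasibleTotals f μ k δ)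

end StructuredBAI

open StructuredBAI

/-! The expected query counts `n(i)` under `μ` form a feasible allocation, and their sum is at most
the expected stopping time. If a count is infinite, the bound is trivial. Otherwise let `Δ` lead to
an instance with another unique best arm. Recommending `k` is then right under `μ` and wrong under
`μ + Δ`, so both error probabilities are at most `δ`. The Bretagnolle–Huber inequality bounds their
sum below by `exp(-KL) / 2`, where `KL = ∑ n(i) Δ_i² / 2`; hence `KL ≥ log (1 / (4δ))`. Continuity
in `Δ` and nondegeneracy extend this to all significant departures.

The divergence is computed at a fixed horizon by induction on rounds (`lintegral_histLaw_add`,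
`integrable_logRatioHist_and_integral_eq`). Rounds after stopping have the same law under every mean
vector and contribute nothing. The horizon then tends to infinity in `exp_neg_sum_div_two_le`.
Attainment of the minimum is a compactness argument. -/

namespace StructuredBAI

/-! ### Histories and the recursion for their law -/

/-- A history extended by one more round. -/
def Hist.snoc {L n : ℕ} (h : Hist L n) (x : Obs L) : Hist L (n + 1) := fun i =>
  if hi : (i : ℕ) ≤ n then h ⟨i, Finset.mem_Iic.2 hi⟩ else x

/-- The history without its last round. -/
def Hist.dropLast {L n : ℕ} (h : Hist L (n + 1)) : Hist L n :=
  Preorder.frestrictLe₂ (π := fun _ : ℕ => Obs L) (Nat.le_succ n) h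

/-- The last round of a history. -/
def Hist.last {L n : ℕ} (h : Hist L n) : Obs L := h ⟨n, Finset.mem_Iic.2 le_rfl⟩

theorem Hist.measurable_snoc {L n : ℕ} :
    Measurable fun p : Hist L n × Obs L => Hist.snoc p.1 p.2 := by
  refine measurable_pi_iff.2 fun i => ?_
  unfold Hist.snoc
  split_ifs with hi
  · exact (measurable_pi_apply _).comp measurable_fst
  · exact measurable_snd

theorem Hist.measurable_dropLast {L n : ℕ} : Measurable (Hist.dropLast (L := L) (n := n)) :=
  measurable_pi_iff.2 fun _ => measurable_pi_apply _

theorem Hist.measurable_last {L n : ℕ} : Measurable (Hist.last (L := L) (n := n)) :=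
  measurable_pi_apply _

@[simp]
theorem Hist.dropLast_snoc {L n : ℕ} (h : Hist L n) (x : Obs L) : (Hist.snoc h x).dropLast = h := by
  funext i
  have hi : (i : ℕ) ≤ n := Finset.mem_Iic.1 i.2
  simp [Hist.dropLast, Hist.snoc, hi]

@[simp]
theorem Hist.last_snoc {L n : ℕ} (h : Hist L n) (x : Obs L) : (Hist.snoc h x).last = x := by
  simp [Hist.last, Hist.snoc]

theorem snoc_frestrictLe {L : ℕ} (n : ℕ) (ω : Path L) :
    Hist.snoc (Preorder.frestrictLe (π := fun _ : ℕ => Obs L) n ω) (ω (n + 1)) =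
      Preorder.frestrictLe (π := fun _ : ℕ => Obs L) (n + 1) ω := by
  funext i
  have hi : (i : ℕ) ≤ n + 1 := Finset.mem_Iic.1 i.2
  by_cases h : (i : ℕ) ≤ n
  · simp [Hist.snoc, h]
  · have : (i : ℕ) = n + 1 := by omega
    simp [Hist.snoc, this]

namespace Learner

variable {L K : ℕ} [NeZero L]

instance (A : Learner L K) (ν : Fin L → ℝ) : IsProbabilityMeasure (A.law ν) := by
  unfold Learner.law
  infer_instance

/-- The law of the first `n + 1` rounds. -/
noncomputable def histLaw (A : Learner L K) (ν : Fin L → ℝ) (n : ℕ) : Measure (Hist L n) :=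
  (A.law ν).map (Preorder.frestrictLe (π := fun _ : ℕ => Obs L) n)

instance (A : Learner L K) (ν : Fin L → ℝ) (n : ℕ) : IsProbabilityMeasure (A.histLaw ν n) :=
  Measure.isProbabilityMeasure_map (Preorder.measurable_frestrictLe n).aemeasurable

theorem histLaw_apply (A : Learner L K) (ν : Fin L → ℝ) (n : ℕ) {s : Set (Hist L n)}
    (hs : MeasurableSet s) : A.histLaw ν n s =
      A.law ν (Preorder.frestrictLe (π := fun _ : ℕ => Obs L) n ⁻¹' s) :=
  Measure.map_apply (Preorder.measurable_frestrictLe n) hs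

theorem histLaw_zero (A : Learner L K) (ν : Fin L → ℝ) :
    A.histLaw ν 0 = (query ν A.first).map (fun x _ => x) := by
  unfold histLaw law Kernel.trajMeasure
  rw [Measure.map_comp _ _ (Preorder.measurable_frestrictLe 0), Kernel.traj_map_frestrictLe,
    Kernel.partialTraj_self, Measure.id_comp]
  congr 1

theorem histLaw_succ (A : Learner L K) (ν : Fin L → ℝ) (n : ℕ) :
    A.histLaw ν (n + 1) =
      (A.histLaw ν n ⊗ₘ A.step ν n).map fun p => Hist.snoc p.1 p.2 := by
  have h := Kernel.map_frestrictLe_trajMeasure_compProd_eq_map_trajMeasure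
    (X := fun _ => Obs L) (μ₀ := query ν A.first) (κ := A.step ν) (a := n)
  unfold histLaw law
  rw [h, Measure.map_map Hist.measurable_snoc
    ((Preorder.measurable_frestrictLe n).prodMk (measurable_pi_apply _))]
  congr 1
  funext ω
  exact (snoc_frestrictLe n ω).symm

theorem lintegral_histLaw_zero (A : Learner L K) (ν : Fin L → ℝ) {F : Hist L 0 → ℝ≥0∞}
    (hF : Measurable F) :
    ∫⁻ h, F h ∂(A.histLaw ν 0) = ∫⁻ x, F (fun _ => x) ∂(query ν A.first) := by
  rw [histLaw_zero, lintegral_map hF (by fun_prop)]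

theorem lintegral_histLaw_succ (A : Learner L K) (ν : Fin L → ℝ) (n : ℕ)
    {F : Hist L (n + 1) → ℝ≥0∞} (hF : Measurable F) :
    ∫⁻ h, F h ∂(A.histLaw ν (n + 1)) =
      ∫⁻ h, ∫⁻ x, F (Hist.snoc h x) ∂(A.step ν n h) ∂(A.histLaw ν n) := by
  rw [histLaw_succ, lintegral_map hF Hist.measurable_snoc,
    Measure.lintegral_compProd (f := fun p => F (Hist.snoc p.1 p.2))
      (hF.comp Hist.measurable_snoc)]

end Learner

/-! ### Likelihood ratio of a single Gaussian observation -/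

theorem query_apply {L : ℕ} (ν : Fin L → ℝ) (i : Fin L) :
    query ν i = (gaussianReal (ν i) 1).map (fun y => (i, y)) := by
  change (Measure.dirac i).prod (gaussianReal (ν i) 1) = _
  rw [Measure.dirac_prod]

/-- The logarithm of the likelihood ratio between the mean vectors `μ + Δ` and `μ` for a single
observation. -/
noncomputable def logRatio {L : ℕ} (μ Δ : Fin L → ℝ) (x : Obs L) : ℝ :=
  Δ x.1 * (x.2 - μ x.1) - Δ x.1 ^ 2 / 2

theorem measurable_logRatio {L : ℕ} (μ Δ : Fin L → ℝ) : Measurable (logRatio μ Δ) := by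
  have h (g : Fin L → ℝ) : Measurable fun x : Obs L => g x.1 :=
    (measurable_of_countable g).comp measurable_fst
  exact ((h Δ).mul (measurable_snd.sub (h μ))).sub (((h Δ).pow_const 2).div_const 2)

theorem lintegral_query_add {L : ℕ} (μ Δ : Fin L → ℝ) (i : Fin L) {F : Obs L → ℝ≥0∞}
    (hF : Measurable F) :
    ∫⁻ x, F x ∂(query (μ + Δ) i) =
      ∫⁻ x, F x * ENNReal.ofReal (Real.exp (logRatio μ Δ x)) ∂(query μ i) := by
  have hm := measurable_logRatio μ Δ
  rw [query_apply, query_apply, lintegral_map hF (by fun_prop),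
    lintegral_map (by fun_prop) (by fun_prop), gaussianReal_of_var_ne_zero _ one_ne_zero,
    gaussianReal_of_var_ne_zero _ one_ne_zero,
    lintegral_withDensity_eq_lintegral_mul _ (by fun_prop) (by fun_prop),
    lintegral_withDensity_eq_lintegral_mul _ (by fun_prop) (by fun_prop)]
  refine lintegral_congr fun y => ?_
  simp only [Pi.mul_apply, gaussianPDF]
  rw [mul_left_comm, mul_comm]
  congr 1
  rw [← ENNReal.ofReal_mul (gaussianPDFReal_nonneg _ _ _)]
  simp only [gaussianPDFReal, logRatio, Pi.add_apply]
  rw [mul_assoc _ (Real.exp _), ← Real.exp_add]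
  congr 3
  simp only [NNReal.coe_one]
  ring

theorem integrable_mul_sub_gaussianReal (a b m : ℝ) :
    Integrable (fun y : ℝ => a * (y - b)) (gaussianReal m 1) :=
  (((memLp_id_gaussianReal 1).integrable le_rfl).sub (integrable_const b)).const_mul a

theorem integrable_logRatio {L : ℕ} (μ Δ : Fin L → ℝ) (i : Fin L) :
    Integrable (logRatio μ Δ) (query μ i) := by
  rw [query_apply, integrable_map_measure (measurable_logRatio μ Δ).aestronglyMeasurable
    (by fun_prop)]
  exact (integrable_mul_sub_gaussianReal (Δ i) (μ i) (μ i)).sub (integrable_const (Δ i ^ 2 / 2))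

/-- The centred linear term integrates to zero; what remains is minus the Kullback–Leibler
divergence of two unit-variance normal laws whose means differ by `Δ i`. -/
theorem integral_logRatio {L : ℕ} (μ Δ : Fin L → ℝ) (i : Fin L) :
    ∫ x, logRatio μ Δ x ∂(query μ i) = -(Δ i ^ 2 / 2) := by
  rw [query_apply, integral_map (by fun_prop) (measurable_logRatio μ Δ).aestronglyMeasurable]
  have h : Integrable (fun y : ℝ => y) (gaussianReal (μ i) 1) :=
    (memLp_id_gaussianReal 1).integrable le_rfl
  simp only [logRatio]
  rw [integral_sub (integrable_mul_sub_gaussianReal _ _ _) (integrable_const _),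
    integral_const_mul, integral_sub (f := fun y : ℝ => y) h (integrable_const _),
    integral_id_gaussianReal]
  simp

end StructuredBAI

/-! ### Likelihood ratio of a history: change of measure and mean -/

namespace StructuredBAI
namespace Learner

variable {L K : ℕ}

open Classical in
/-- The contribution of a round with outcome `x`, following the history `h`, to the log-likelihood
ratio between the mean vectors `μ + Δ` and `μ`. -/
noncomputable def logRatioStep (A : Learner L K) (μ Δ : Fin L → ℝ) (n : ℕ) (h : Hist L n)
    (x : Obs L) : ℝ :=
  if h ∈ A.stopped n then 0 else logRatio μ Δ x

/-- The log-likelihood ratio of a history between the mean vectors `μ + Δ` and `μ`. -/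
noncomputable def logRatioHist (A : Learner L K) (μ Δ : Fin L → ℝ) : (n : ℕ) → Hist L n → ℝ
  | 0, h => logRatio μ Δ h.last
  | n + 1, h => A.logRatioHist μ Δ n h.dropLast + A.logRatioStep μ Δ n h.dropLast h.last

theorem measurable_logRatioStep (A : Learner L K) (μ Δ : Fin L → ℝ) (n : ℕ) :
    Measurable fun p : Hist L n × Obs L => A.logRatioStep μ Δ n p.1 p.2 := by
  classical
  exact Measurable.ite (measurable_fst (A.measurableSet_stopped n)) measurable_const
    ((measurable_logRatio μ Δ).comp measurable_snd)

theorem measurable_logRatioHist (A : Learner L K) (μ Δ : Fin L → ℝ) (n : ℕ) :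
    Measurable (A.logRatioHist μ Δ n) := by
  induction n with
  | zero => exact (measurable_logRatio μ Δ).comp Hist.measurable_last
  | succ n ih =>
    exact (ih.comp Hist.measurable_dropLast).add
      ((A.measurable_logRatioStep μ Δ n).comp (Hist.measurable_dropLast.prodMk Hist.measurable_last))

theorem logRatioHist_snoc (A : Learner L K) (μ Δ : Fin L → ℝ) (n : ℕ) (h : Hist L n) (x : Obs L) :
    A.logRatioHist μ Δ (n + 1) (h.snoc x) =
      A.logRatioHist μ Δ n h + A.logRatioStep μ Δ n h x := by
  simp [logRatioHist]

theorem integrable_ite_next (A : Learner L K) (n : ℕ) (g : Fin L → ℝ) (P : Measure (Hist L n))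
    [IsFiniteMeasure P] [∀ h, Decidable (h ∈ A.stopped n)] :
    Integrable (fun h => if h ∈ A.stopped n then 0 else g (A.next n h)) P := by
  refine Integrable.of_bound (C := ∑ i, |g i|) (Measurable.ite (A.measurableSet_stopped n)
    measurable_const ((measurable_of_countable g).comp
      (A.measurable_next n))).aestronglyMeasurable (ae_of_all _ fun h => ?_)
  rw [Real.norm_eq_abs]
  split_ifs
  · simpa using Finset.sum_nonneg fun i _ => abs_nonneg (g i)
  · exact Finset.single_le_sum (f := fun i => |g i|) (fun i _ => abs_nonneg _)
      (Finset.mem_univ (A.next n h))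

variable [NeZero L]

theorem step_of_mem (A : Learner L K) (ν : Fin L → ℝ) (n : ℕ) {h : Hist L n}
    (hh : h ∈ A.stopped n) : A.step ν n h = Measure.dirac ((0 : Fin L), (0 : ℝ)) := by
  classical
  rw [step, Kernel.piecewise_apply, if_pos hh, Kernel.const_apply]

theorem step_of_notMem (A : Learner L K) (ν : Fin L → ℝ) (n : ℕ) {h : Hist L n}
    (hh : h ∉ A.stopped n) : A.step ν n h = query ν (A.next n h) := by
  classical
  rw [step, Kernel.piecewise_apply, if_neg hh, Kernel.comap_apply]

/-- After stopping, the next round is the same Dirac mass under both mean vectors, so the density is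
one there; before stopping, this is the single-observation formula. -/
theorem lintegral_step_add (A : Learner L K) (μ Δ : Fin L → ℝ) (n : ℕ) (h : Hist L n)
    {F : Obs L → ℝ≥0∞} (hF : Measurable F) :
    ∫⁻ x, F x ∂(A.step (μ + Δ) n h) =
      ∫⁻ x, F x * ENNReal.ofReal (Real.exp (A.logRatioStep μ Δ n h x)) ∂(A.step μ n h) := by
  by_cases hh : h ∈ A.stopped n
  · simp [step_of_mem A _ n hh, logRatioStep, hh]
  · simp only [step_of_notMem A _ n hh, logRatioStep, hh, if_false]
    exact lintegral_query_add μ Δ _ hF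

/-- Change of measure for the law of the first `n + 1` rounds. -/
theorem lintegral_histLaw_add (A : Learner L K) (μ Δ : Fin L → ℝ) (n : ℕ)
    {F : Hist L n → ℝ≥0∞} (hF : Measurable F) :
    ∫⁻ h, F h ∂(A.histLaw (μ + Δ) n) =
      ∫⁻ h, F h * ENNReal.ofReal (Real.exp (A.logRatioHist μ Δ n h)) ∂(A.histLaw μ n) := by
  induction n with
  | zero =>
    have hm := A.measurable_logRatioHist μ Δ 0
    rw [lintegral_histLaw_zero A _ hF, lintegral_histLaw_zero A _ (by fun_prop),
      lintegral_query_add μ Δ _ (F := fun x => F fun _ => x)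
        (hF.comp (by fun_prop))]
    rfl
  | succ n ih =>
    have hm := A.measurable_logRatioHist μ Δ (n + 1)
    have hm' := A.measurable_logRatioHist μ Δ n
    have hG : Measurable fun p : Hist L n × Obs L => F (Hist.snoc p.1 p.2) :=
      hF.comp Hist.measurable_snoc
    rw [lintegral_histLaw_succ A _ n hF, lintegral_histLaw_succ A _ n (by fun_prop),
      ih (Measurable.lintegral_kernel_prod_right hG)]
    refine lintegral_congr fun h => ?_
    have hs : Measurable (A.logRatioStep μ Δ n h) :=
      (A.measurable_logRatioStep μ Δ n).comp measurable_prodMk_left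
    have hGh : Measurable fun x => F (h.snoc x) := hG.comp measurable_prodMk_left
    have hmul : Measurable fun x =>
        F (h.snoc x) * ENNReal.ofReal (Real.exp (A.logRatioStep μ Δ n h x)) :=
      hGh.mul (by fun_prop)
    rw [lintegral_step_add A μ Δ n h hGh, ← lintegral_mul_const _ hmul]
    refine lintegral_congr fun x => ?_
    rw [logRatioHist_snoc, Real.exp_add, ENNReal.ofReal_mul (Real.exp_nonneg _), mul_assoc,
      mul_comm (ENNReal.ofReal (Real.exp (A.logRatioHist μ Δ n h)))]

theorem integrable_logRatioStep (A : Learner L K) (μ Δ : Fin L → ℝ) (n : ℕ) (h : Hist L n) :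
    Integrable (A.logRatioStep μ Δ n h) (A.step μ n h) := by
  by_cases hh : h ∈ A.stopped n
  · have : A.logRatioStep μ Δ n h = fun _ => 0 := by
      funext x
      simp [logRatioStep, hh]
    rw [this]
    exact integrable_const _
  · have : A.logRatioStep μ Δ n h = logRatio μ Δ := by
      funext x
      simp [logRatioStep, hh]
    rw [this, step_of_notMem A _ n hh]
    exact integrable_logRatio μ Δ _

-- Used twice: with the norm for integrability and with the identity for the mean. The condition on
-- `φ` makes stopped histories contribute zero.
open Classical in
theorem integral_comp_logRatioStep (A : Learner L K) (μ Δ : Fin L → ℝ) (n : ℕ) (h : Hist L n)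
    {φ : ℝ → ℝ} (hφ : φ 0 = 0) :
    ∫ x, φ (A.logRatioStep μ Δ n h x) ∂(A.step μ n h) =
      if h ∈ A.stopped n then 0 else ∫ x, φ (logRatio μ Δ x) ∂(query μ (A.next n h)) := by
  split_ifs with hh
  · simp [logRatioStep, hh, hφ]
  · simp [logRatioStep, hh, step_of_notMem A _ n hh]

theorem integrable_logRatioStep_compProd (A : Learner L K) (μ Δ : Fin L → ℝ) (n : ℕ) :
    Integrable (fun p : Hist L n × Obs L => A.logRatioStep μ Δ n p.1 p.2)
      (A.histLaw μ n ⊗ₘ A.step μ n) := by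
  classical
  rw [Measure.integrable_compProd_iff (A.measurable_logRatioStep μ Δ n).aestronglyMeasurable]
  refine ⟨ae_of_all _ fun h => A.integrable_logRatioStep μ Δ n h, ?_⟩
  simp_rw [A.integral_comp_logRatioStep μ Δ n _ (φ := fun r => ‖r‖) norm_zero]
  exact A.integrable_ite_next n (fun i => ∫ x, ‖logRatio μ Δ x‖ ∂(query μ i)) _

/-- The probability that micro-observable `i` is queried in the round numbered `n`. -/
noncomputable def queryProb (A : Learner L K) (μ : Fin L → ℝ) (i : Fin L) : ℕ → ℝ≥0∞
  | 0 => if A.first = i then 1 else 0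
  | n + 1 => A.histLaw μ n ((A.stopped n)ᶜ ∩ A.next n ⁻¹' {i})

theorem queryProb_ne_top (A : Learner L K) (μ : Fin L → ℝ) (i : Fin L) (n : ℕ) :
    A.queryProb μ i n ≠ ⊤ := by
  cases n with
  | zero =>
    unfold queryProb
    split_ifs <;> simp
  | succ n => exact measure_ne_top _ _

theorem integral_logRatioStep_compProd (A : Learner L K) (μ Δ : Fin L → ℝ) (n : ℕ) :
    ∫ p, A.logRatioStep μ Δ n p.1 p.2 ∂(A.histLaw μ n ⊗ₘ A.step μ n) =
      -∑ i, (A.queryProb μ i (n + 1)).toReal * (Δ i ^ 2 / 2) := by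
  classical
  rw [Measure.integral_compProd (A.integrable_logRatioStep_compProd μ Δ n)]
  simp_rw [A.integral_comp_logRatioStep μ Δ n _ (φ := fun r => r) rfl, integral_logRatio]
  have hm (i : Fin L) : MeasurableSet ((A.stopped n)ᶜ ∩ A.next n ⁻¹' {i}) :=
    (A.measurableSet_stopped n).compl.inter (A.measurable_next n (measurableSet_singleton i))
  -- Splitting by the queried index turns the integral into a combination of query probabilities.
  have h (h : Hist L n) : (if h ∈ A.stopped n then 0 else -(Δ (A.next n h) ^ 2 / 2)) =
      ∑ i, ((A.stopped n)ᶜ ∩ A.next n ⁻¹' {i}).indicator (fun _ => -(Δ i ^ 2 / 2)) h := by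
    split_ifs with hh
    · simp [Set.indicator, hh]
    · simp [Set.indicator, hh]
  simp_rw [h]
  rw [integral_finsetSum _ fun i _ => (integrable_const _).indicator (hm i),
    ← Finset.sum_neg_distrib]
  refine Finset.sum_congr rfl fun i _ => ?_
  rw [integral_indicator_const _ (hm i)]
  simp [queryProb, Measure.real]

theorem integrable_logRatioHist_and_integral_eq (A : Learner L K) (μ Δ : Fin L → ℝ) (n : ℕ) :
    Integrable (A.logRatioHist μ Δ n) (A.histLaw μ n) ∧
      ∫ h, A.logRatioHist μ Δ n h ∂(A.histLaw μ n) =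
        -∑ t ∈ Finset.range (n + 1), ∑ i, (A.queryProb μ i t).toReal * (Δ i ^ 2 / 2) := by
  induction n with
  | zero =>
    have hm := (A.measurable_logRatioHist μ Δ 0).aestronglyMeasurable
      (μ := (query μ A.first).map fun x _ => x)
    rw [histLaw_zero]
    refine ⟨(integrable_map_measure hm (by fun_prop)).2 (integrable_logRatio μ Δ A.first), ?_⟩
    rw [integral_map (by fun_prop) hm]
    refine (integral_logRatio μ Δ A.first).trans ?_
    simp [queryProb, apply_ite ENNReal.toReal]
  | succ n ih =>
    have hm := (A.measurable_logRatioHist μ Δ (n + 1)).aestronglyMeasurable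
      (μ := (A.histLaw μ n ⊗ₘ A.step μ n).map fun p => Hist.snoc p.1 p.2)
    have hfst : (A.histLaw μ n ⊗ₘ A.step μ n).map Prod.fst = A.histLaw μ n :=
      Measure.fst_compProd _ _
    have hm' := (A.measurable_logRatioHist μ Δ n).aestronglyMeasurable
      (μ := (A.histLaw μ n ⊗ₘ A.step μ n).map Prod.fst)
    have h₁ : Integrable (fun p => A.logRatioHist μ Δ n p.1) (A.histLaw μ n ⊗ₘ A.step μ n) := by
      refine (integrable_map_measure hm' measurable_fst.aemeasurable).1 ?_
      rw [hfst]
      exact ih.1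
    have h₂ := A.integrable_logRatioStep_compProd μ Δ n
    have h₃ : ∫ p, A.logRatioHist μ Δ n p.1 ∂(A.histLaw μ n ⊗ₘ A.step μ n) =
        ∫ h, A.logRatioHist μ Δ n h ∂(A.histLaw μ n) := by
      rw [← integral_map measurable_fst.aemeasurable hm', hfst]
    rw [histLaw_succ]
    refine ⟨(integrable_map_measure hm Hist.measurable_snoc.aemeasurable).2 ?_, ?_⟩
    · refine (h₁.add h₂).congr (ae_of_all _ fun p => ?_)
      simp [logRatioHist_snoc]
    · rw [integral_map Hist.measurable_snoc.aemeasurable hm]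
      simp_rw [logRatioHist_snoc]
      rw [integral_add h₁ h₂, h₃, ih.2, integral_logRatioStep_compProd,
        Finset.sum_range_succ _ (n + 1), neg_add]

end Learner
end StructuredBAI

/-! ### Stopping time and recommendation in terms of finite histories -/

namespace StructuredBAI
namespace Learner

variable {L K : ℕ}

/-- The paths on which the learner makes a query in the round numbered `t`. -/
def active (A : Learner L K) : ℕ → Set (Path L)
  | 0 => Set.univ
  | n + 1 => Preorder.frestrictLe (π := fun _ : ℕ => Obs L) n ⁻¹' (A.stopped n)ᶜ

theorem measurableSet_active (A : Learner L K) (t : ℕ) : MeasurableSet (A.active t) := by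
  cases t with
  | zero => exact MeasurableSet.univ
  | succ n => exact Preorder.measurable_frestrictLe n (A.measurableSet_stopped n).compl

theorem notMem_active_of_stopsAt (A : Learner L K) {ω : Path L} {m t : ℕ} (h : A.StopsAt ω m)
    (hmt : m < t) : ω ∉ A.active t := by
  cases t with
  | zero => omega
  | succ n =>
    intro hω
    exact hω (Set.mem_iUnion₂.2 ⟨m, Nat.lt_succ_iff.1 hmt, h⟩)

theorem tsum_indicator_active_le (A : Learner L K) (ω : Path L) :
    ∑' t, (A.active t).indicator (1 : Path L → ℝ≥0∞) ω ≤ (A.T ω : ℝ≥0∞) := by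
  classical
  unfold T
  split_ifs with h
  · rw [tsum_eq_sum (s := Finset.range (Nat.find h + 1)) fun t ht => Set.indicator_of_notMem
      (A.notMem_active_of_stopsAt (Nat.find_spec h) (by simpa using ht)) _]
    refine (Finset.sum_le_sum fun t _ => Set.indicator_le_self _ _ _).trans ?_
    simp
  · simp

theorem sum_queryProb [NeZero L] (A : Learner L K) (μ : Fin L → ℝ) (t : ℕ) :
    ∑ i, A.queryProb μ i t = A.law μ (A.active t) := by
  cases t with
  | zero => simp [queryProb, active]
  | succ n =>
    have hm (i : Fin L) : MeasurableSet (A.next n ⁻¹' {i}) :=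
      A.measurable_next n (measurableSet_singleton i)
    have hs := (A.measurableSet_stopped n).compl
    simp only [queryProb, active]
    rw [← histLaw_apply A μ n hs, ← measure_biUnion_finset]
    · congr 1
      ext h
      simp
    · intro i _ j _ hij
      exact ((Set.disjoint_singleton.2 hij).preimage (A.next n)).mono Set.inter_subset_right
        Set.inter_subset_right
    · exact fun i _ => hs.inter (hm i)

/-- Each active round makes exactly one query, and the number of active rounds is at most `T`;
Tonelli's theorem exchanges sum and expectation. -/
theorem sum_tsum_queryProb_le [NeZero L] (A : Learner L K) (μ : Fin L → ℝ) :
    ∑ i, ∑' t, A.queryProb μ i t ≤ ∫⁻ ω, (A.T ω : ℝ≥0∞) ∂(A.law μ) := by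
  rw [← Summable.tsum_finsetSum fun _ _ => ENNReal.summable]
  calc ∑' t, ∑ i, A.queryProb μ i t
      = ∑' t, ∫⁻ ω, (A.active t).indicator 1 ω ∂(A.law μ) := by
        refine tsum_congr fun t => ?_
        rw [sum_queryProb, lintegral_indicator_one (A.measurableSet_active t)]
    _ = ∫⁻ ω, ∑' t, (A.active t).indicator 1 ω ∂(A.law μ) :=
        (lintegral_tsum fun t =>
          (measurable_one.indicator (A.measurableSet_active t)).aemeasurable).symm
    _ ≤ _ := lintegral_mono fun ω => A.tsum_indicator_active_le ω

/-- The histories after whose last round the learner stops for the first time and recommends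
arm `k`. -/
def answered (A : Learner L K) (k : Fin K) (m : ℕ) : Set (Hist L m) :=
  A.stopSet m ∩ A.answer m ⁻¹' {k} ∩ ⋂ (l : ℕ) (hl : l < m),
    Preorder.frestrictLe₂ (π := fun _ : ℕ => Obs L) hl.le ⁻¹' (A.stopSet l)ᶜ

/-- The histories in which the learner has recommended arm `k` in the last round or before. -/
def answeredBy (A : Learner L K) (k : Fin K) (n : ℕ) : Set (Hist L n) :=
  ⋃ (m : ℕ) (hm : m ≤ n), Preorder.frestrictLe₂ (π := fun _ : ℕ => Obs L) hm ⁻¹' A.answered k m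

theorem measurableSet_answeredBy (A : Learner L K) (k : Fin K) (n : ℕ) :
    MeasurableSet (A.answeredBy k n) := by
  refine MeasurableSet.iUnion fun m => MeasurableSet.iUnion fun hm =>
    Preorder.measurable_frestrictLe₂ hm ?_
  refine ((A.measurableSet_stopSet m).inter
    (A.measurable_answer m (measurableSet_singleton k))).inter ?_
  exact MeasurableSet.iInter fun l => MeasurableSet.iInter fun hl =>
    Preorder.measurable_frestrictLe₂ hl.le (A.measurableSet_stopSet l).compl

theorem mem_answeredBy (A : Learner L K) (k : Fin K) (n : ℕ) (ω : Path L) :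
    Preorder.frestrictLe (π := fun _ : ℕ => Obs L) n ω ∈ A.answeredBy k n ↔
      ∃ m ≤ n, Preorder.frestrictLe (π := fun _ : ℕ => Obs L) m ω ∈ A.answered k m := by
  simp only [answeredBy, Set.mem_iUnion, ← exists_prop]
  rfl

theorem mem_answered (A : Learner L K) (k : Fin K) (m : ℕ) (ω : Path L) :
    Preorder.frestrictLe (π := fun _ : ℕ => Obs L) m ω ∈ A.answered k m ↔
      (A.StopsAt ω m ∧ A.answer m (Preorder.frestrictLe (π := fun _ : ℕ => Obs L) m ω) = k) ∧
        ∀ l < m, ¬ A.StopsAt ω l := by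
  simp only [answered, Set.mem_inter_iff, Set.mem_iInter]
  rfl

/-- Expresses the recommendation as a countable union of events, each decided by a finite history.
-/
theorem J_eq_some_iff (A : Learner L K) (k : Fin K) (ω : Path L) :
    A.J ω = some k ↔
      ∃ m, Preorder.frestrictLe (π := fun _ : ℕ => Obs L) m ω ∈ A.answered k m := by
  classical
  simp only [mem_answered]
  unfold J
  constructor
  · intro hJ
    split_ifs at hJ with h
    exact ⟨Nat.find h, ⟨Nat.find_spec h, Option.some_injective _ hJ⟩, fun l hl => Nat.find_min h hl⟩
  · rintro ⟨m, ⟨hm, hk⟩, hl⟩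
    have h : ∃ n, A.StopsAt ω n := ⟨m, hm⟩
    have hf : Nat.find h = m := (Nat.find_eq_iff h).2 ⟨hm, hl⟩
    rw [dif_pos h]
    subst hf
    rw [hk]

end Learner

/-! ### The Bretagnolle–Huber inequality -/

/-- With `a = exp (m / 2)` and `b = exp (l / 2)`, the tangent bound `1 + x ≤ exp x` makes the left
side at most `ab - a²(1 + b²) / 4`. This is at most `1` and at most `b²` because `(ab/2 - 1)²` and
`(a/2 - b)²` are nonnegative. Being affine in `l` and `exp l`, the left side can be integrated
exactly. -/
theorem exp_mul_sub_le_min (l m : ℝ) :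
    Real.exp m * (1 + (l - m) / 2) - Real.exp m * (1 + Real.exp l) / 4 ≤ min 1 (Real.exp l) := by
  have h := Real.add_one_le_exp ((l - m) / 2)
  have ha : Real.exp m = Real.exp (m / 2) ^ 2 := by
    rw [← Real.exp_nat_mul]
    congr 1
    push_cast
    ring
  have hb : Real.exp l = Real.exp (l / 2) ^ 2 := by
    rw [← Real.exp_nat_mul]
    congr 1
    push_cast
    ring
  have hab : Real.exp m * Real.exp ((l - m) / 2) = Real.exp (m / 2) * Real.exp (l / 2) := by
    rw [← Real.exp_add, ← Real.exp_add]
    congr 1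
    ring
  have h' : Real.exp m * (1 + (l - m) / 2) ≤ Real.exp (m / 2) * Real.exp (l / 2) := by
    rw [← hab]
    exact mul_le_mul_of_nonneg_left (by linarith) (Real.exp_nonneg m)
  rw [ha, hb] at *
  refine (sub_le_sub_right h' _).trans (le_min ?_ ?_)
  · nlinarith [sq_nonneg (Real.exp (m / 2) * Real.exp (l / 2) / 2 - 1),
      sq_nonneg (Real.exp (m / 2))]
  · nlinarith [sq_nonneg (Real.exp (m / 2) / 2 - Real.exp (l / 2)),
      sq_nonneg (Real.exp (m / 2) * Real.exp (l / 2))]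

/-- The Bretagnolle–Huber inequality, for a measure `Q` with density `exp ∘ ℓ` with respect
to `P`. -/
theorem ofReal_exp_integral_div_two_le {Ω : Type*} [MeasurableSpace Ω] {P Q : Measure Ω}
    [IsProbabilityMeasure P] [IsProbabilityMeasure Q] {ℓ : Ω → ℝ} (hm : Measurable ℓ)
    (hi : Integrable ℓ P)
    (hQ : ∀ F : Ω → ℝ≥0∞, Measurable F →
      ∫⁻ h, F h ∂Q = ∫⁻ h, F h * ENNReal.ofReal (Real.exp (ℓ h)) ∂P)
    {E : Set Ω} (hE : MeasurableSet E) :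
    ENNReal.ofReal (Real.exp (∫ h, ℓ h ∂P) / 2) ≤ P Eᶜ + Q E := by
  set m := ∫ h, ℓ h ∂P with hm_def
  have h_one : ∫⁻ h, ENNReal.ofReal (Real.exp (ℓ h)) ∂P = 1 := by
    have h := hQ (fun _ => 1) measurable_const
    simpa using h.symm
  have he : Integrable (fun h => Real.exp (ℓ h)) P := by
    refine ⟨by fun_prop, ?_⟩
    rw [hasFiniteIntegral_iff_ofReal (ae_of_all _ fun h => Real.exp_nonneg _), h_one]
    exact ENNReal.one_lt_top
  have he_one : ∫ h, Real.exp (ℓ h) ∂P = 1 := by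
    rw [integral_eq_lintegral_of_nonneg_ae (ae_of_all _ fun h => Real.exp_nonneg _)
      (by fun_prop), h_one, ENNReal.toReal_one]
  have hmin : Integrable (fun h => min 1 (Real.exp (ℓ h))) P := (integrable_const 1).inf he
  have hdiff : Integrable (fun h => (ℓ h - m) / 2) P :=
    (hi.sub (integrable_const m)).div_const 2
  have hlow₁ : Integrable (fun h => Real.exp m * (1 + (ℓ h - m) / 2)) P :=
    ((integrable_const _).add hdiff).const_mul _
  have hlow₂ : Integrable (fun h => Real.exp m * (1 + Real.exp (ℓ h)) / 4) P :=
    (((integrable_const _).add he).const_mul _).div_const 4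
  -- Since `ℓ` has mean `m` and `exp ∘ ℓ` has mean `1`, the lower bound integrates to `exp m - exp m
  -- / 2`.
  have hint : Real.exp m / 2 ≤ ∫ h, min 1 (Real.exp (ℓ h)) ∂P := by
    refine le_trans (le_of_eq ?_)
      (integral_mono (hlow₁.sub hlow₂) hmin fun h => exp_mul_sub_le_min (ℓ h) m)
    have h₁ : ∫ h, Real.exp m * (1 + (ℓ h - m) / 2) ∂P = Real.exp m := by
      rw [integral_const_mul, integral_add (integrable_const _) hdiff, integral_div,
        integral_sub hi (integrable_const _), ← hm_def]
      simp
    have h₂ : ∫ h, Real.exp m * (1 + Real.exp (ℓ h)) / 4 ∂P = Real.exp m * 2 / 4 := by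
      rw [integral_div, integral_const_mul, integral_add (integrable_const _) he, he_one]
      norm_num
    refine Eq.trans ?_ (integral_sub hlow₁ hlow₂).symm
    rw [h₁, h₂]
    ring
  calc ENNReal.ofReal (Real.exp m / 2)
      ≤ ENNReal.ofReal (∫ h, min 1 (Real.exp (ℓ h)) ∂P) := ENNReal.ofReal_le_ofReal hint
    _ = ∫⁻ h, ENNReal.ofReal (min 1 (Real.exp (ℓ h))) ∂P :=
        ofReal_integral_eq_lintegral_ofReal hmin
          (ae_of_all _ fun h => le_min zero_le_one (Real.exp_nonneg _))
    -- The minimum is bounded by the density on `E` and by `1` off `E`.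
    _ ≤ ∫⁻ h, (Eᶜ.indicator 1 h + E.indicator 1 h * ENNReal.ofReal (Real.exp (ℓ h))) ∂P := by
        refine lintegral_mono fun h => ?_
        by_cases hh : h ∈ E
        · simp only [Set.indicator, Set.mem_compl_iff, hh, not_true, if_false, if_true,
            Pi.one_apply, zero_add, one_mul]
          exact ENNReal.ofReal_le_ofReal (min_le_right _ _)
        · simp only [Set.indicator, Set.mem_compl_iff, hh, not_false_iff, if_false, if_true,
            Pi.one_apply, zero_mul, add_zero]
          exact (ENNReal.ofReal_le_ofReal (min_le_left _ _)).trans_eq ENNReal.ofReal_one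
    _ = P Eᶜ + Q E := by
        rw [lintegral_add_left (measurable_one.indicator hE.compl),
          lintegral_indicator_one hE.compl, ← hQ _ (measurable_one.indicator hE),
          lintegral_indicator_one hE]

/-! ### Error probabilities and expected query counts -/

namespace Learner

variable {L K : ℕ} [NeZero L]

/-- The expected number of queries of micro-observable `i`. -/
noncomputable def expectedQueries (A : Learner L K) (μ : Fin L → ℝ) (i : Fin L) : ℝ≥0∞ :=
  ∑' t, A.queryProb μ i t

theorem sum_queryProb_toReal_le (A : Learner L K) (μ Δ : Fin L → ℝ)
    (hA : ∀ i, A.expectedQueries μ i ≠ ⊤) (n : ℕ) :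
    ∑ t ∈ Finset.range n, ∑ i, (A.queryProb μ i t).toReal * (Δ i ^ 2 / 2) ≤
      ∑ i, (A.expectedQueries μ i).toReal * (Δ i ^ 2 / 2) := by
  rw [Finset.sum_comm]
  refine Finset.sum_le_sum fun i _ => ?_
  rw [← Finset.sum_mul]
  refine mul_le_mul_of_nonneg_right ?_ (by positivity)
  rw [← ENNReal.toReal_sum fun t _ => A.queryProb_ne_top μ i t]
  exact ENNReal.toReal_mono (hA i) (ENNReal.sum_le_tsum _)

/-- A lower bound on the probability of misclassification of a learner that tells apart `μ` and
`μ + Δ` by recommending arm `k` on `μ`, but not on `μ + Δ`. -/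
theorem exp_neg_sum_div_two_le (A : Learner L K) (μ Δ : Fin L → ℝ)
    (hA : ∀ i, A.expectedQueries μ i ≠ ⊤) (k : Fin K) :
    ENNReal.ofReal (Real.exp (-∑ i, (A.expectedQueries μ i).toReal * (Δ i ^ 2 / 2)) / 2) ≤
      A.law μ {ω | A.J ω ≠ some k} + A.law (μ + Δ) {ω | A.J ω = some k} := by
  -- These events are decided by the first `n + 1` rounds, where the change of measure applies, and
  -- increase to the event that `k` is recommended.
  let E (n : ℕ) : Set (Path L) :=
    Preorder.frestrictLe (π := fun _ : ℕ => Obs L) n ⁻¹' A.answeredBy k n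
  have hE (n : ℕ) : MeasurableSet (E n) :=
    Preorder.measurable_frestrictLe n (A.measurableSet_answeredBy k n)
  have hbound (n : ℕ) :
      ENNReal.ofReal (Real.exp (-∑ i, (A.expectedQueries μ i).toReal * (Δ i ^ 2 / 2)) / 2) ≤
        A.law μ (E n)ᶜ + A.law (μ + Δ) {ω | A.J ω = some k} := by
    obtain ⟨hi, hmean⟩ := A.integrable_logRatioHist_and_integral_eq μ Δ n
    have h := ofReal_exp_integral_div_two_le (A.measurable_logRatioHist μ Δ n) hi
      (Q := A.histLaw (μ + Δ) n) (fun F hF => A.lintegral_histLaw_add μ Δ n hF)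
      (A.measurableSet_answeredBy k n)
    rw [hmean, histLaw_apply A _ n (A.measurableSet_answeredBy k n),
      histLaw_apply A _ n (A.measurableSet_answeredBy k n).compl] at h
    refine (ENNReal.ofReal_le_ofReal ?_).trans
      (h.trans (add_le_add_right (measure_mono fun ω hω => ?_) _))
    -- The divergence up to a finite horizon is at most the full one.
    · have := A.sum_queryProb_toReal_le μ Δ hA (n + 1)
      gcongr
    · obtain ⟨m, -, hm⟩ := (A.mem_answeredBy k n ω).1 hω
      exact (A.J_eq_some_iff k ω).2 ⟨m, hm⟩
  have hanti : Antitone fun n => (E n)ᶜ := by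
    refine fun a b hab => Set.compl_subset_compl.2 fun ω hω => ?_
    obtain ⟨m, hm, h⟩ := (A.mem_answeredBy k a ω).1 hω
    exact (A.mem_answeredBy k b ω).2 ⟨m, hm.trans hab, h⟩
  have hinter : ⋂ n, (E n)ᶜ = {ω | A.J ω ≠ some k} := by
    ext ω
    simp only [Set.mem_iInter, Set.mem_compl_iff, Set.mem_ofPred_eq, ne_eq, J_eq_some_iff,
      not_exists, E, Set.mem_preimage, mem_answeredBy, not_and]
    exact ⟨fun h m => h m m le_rfl, fun h _ m _ => h m⟩
  have hlim := tendsto_measure_iInter_atTop (μ := A.law μ)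
    (fun n => (hE n).compl.nullMeasurableSet) hanti ⟨0, measure_ne_top _ _⟩
  rw [hinter] at hlim
  exact ge_of_tendsto' (hlim.add_const _) hbound

end Learner

/-! ### Feasibility, attainment and the lower bound -/

theorem two_mul_log_le_sum {L K : ℕ} [NeZero L] {f : (Fin L → ℝ) → (Fin K → ℝ)} {δ : ℝ}
    (hδ : 0 < δ) {A : Learner L K} (hA : Admissible f δ A) {μ : Fin L → ℝ} {k : Fin K}
    (hk : IsUniqueBest f μ k) (hfin : ∀ i, A.expectedQueries μ i ≠ ⊤) {Δ : Fin L → ℝ}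
    (hΔ : Δ ∈ changesBestArm f μ k) :
    2 * Real.log (1 / (4 * δ)) ≤ ∑ i, (A.expectedQueries μ i).toReal * Δ i ^ 2 := by
  obtain ⟨j, hjk, hj⟩ := hΔ
  have h := A.exp_neg_sum_div_two_le μ Δ hfin k
  have hQ : A.law (μ + Δ) {ω | A.J ω = some k} ≤ ENNReal.ofReal δ := by
    refine (measure_mono fun ω hω => ?_).trans (hA (μ + Δ) j hj).1
    rw [Set.mem_ofPred_eq] at hω ⊢
    rw [hω]
    exact fun h => hjk (Option.some_injective _ h).symm
  have h' := h.trans (add_le_add (hA μ k hk).1 hQ)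
  -- Two errors of at most `δ` give `exp(-KL) / 2 ≤ 2δ`, hence the constant `4δ`.
  rw [← ENNReal.ofReal_add hδ.le hδ.le, ENNReal.ofReal_le_ofReal_iff (by positivity)] at h'
  have hlog := (Real.le_log_iff_exp_le (by positivity : 0 < 4 * δ)).2
    (by linarith : Real.exp (-∑ i, (A.expectedQueries μ i).toReal * (Δ i ^ 2 / 2)) ≤ 4 * δ)
  have hsum : ∑ i, (A.expectedQueries μ i).toReal * (Δ i ^ 2 / 2) =
      (∑ i, (A.expectedQueries μ i).toReal * Δ i ^ 2) / 2 := by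
    rw [Finset.sum_div]
    exact Finset.sum_congr rfl fun i _ => by ring
  rw [one_div, Real.log_inv]
  linarith

/-- For fixed counts the constraint is closed in `Δ`, so it passes from `changesBestArm` to its
closure. -/
theorem expectedQueries_mem_feasible {L K : ℕ} [NeZero L] {f : (Fin L → ℝ) → (Fin K → ℝ)} {δ : ℝ}
    (hδ : 0 < δ) {A : Learner L K} (hA : Admissible f δ A) {μ : Fin L → ℝ} {k : Fin K}
    (hk : IsUniqueBest f μ k) (hf : significantDepartures f μ k ⊆ closure (changesBestArm f μ k))
    (hfin : ∀ i, A.expectedQueries μ i ≠ ⊤) :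
    (fun i => (A.expectedQueries μ i).toReal) ∈ feasible f μ k δ := by
  refine ⟨fun i => ENNReal.toReal_nonneg, fun Δ hΔ => ?_⟩
  have hc : IsClosed {Δ : Fin L → ℝ |
      2 * Real.log (1 / (4 * δ)) ≤ ∑ i, (A.expectedQueries μ i).toReal * Δ i ^ 2} :=
    isClosed_le continuous_const (by fun_prop)
  exact closure_minimal (fun Δ hΔ => two_mul_log_le_sum hδ hA hk hfin hΔ) hc (hf hΔ)

theorem isClosed_feasible {L K : ℕ} (f : (Fin L → ℝ) → (Fin K → ℝ)) (μ : Fin L → ℝ) (k : Fin K)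
    (δ : ℝ) : IsClosed (feasible f μ k δ) := by
  have : feasible f μ k δ = (⋂ i, {n | 0 ≤ n i}) ∩ ⋂ Δ ∈ significantDepartures f μ k,
      {n | 2 * Real.log (1 / (4 * δ)) ≤ ∑ i, n i * Δ i ^ 2} := by
    ext n
    simp [feasible]
  rw [this]
  refine (isClosed_iInter fun i => isClosed_le continuous_const (by fun_prop)).inter
    (isClosed_biInter fun Δ _ => isClosed_le continuous_const (by fun_prop))

theorem isLeast_tauStar {L K : ℕ} {f : (Fin L → ℝ) → (Fin K → ℝ)} {μ : Fin L → ℝ} {k : Fin K}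
    {δ : ℝ} (h : (feasibleTotals f μ k δ).Nonempty) :
    IsLeast (feasibleTotals f μ k δ) (tauStar f μ k δ) := by
  obtain ⟨-, n₀, hn₀, -⟩ := h
  -- Capping the total by that of one feasible point gives compactness: nonnegative coordinates are
  -- bounded by their sum.
  let S : Set (Fin L → ℝ) := feasible f μ k δ ∩ {n | ∑ i, n i ≤ ∑ i, n₀ i}
  have hS : IsCompact S := by
    refine (isCompact_Icc (a := (0 : Fin L → ℝ)) (b := fun _ => ∑ i, n₀ i)).of_isClosed_subset
      ((isClosed_feasible f μ k δ).inter (isClosed_le (by fun_prop) continuous_const)) ?_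
    rintro n ⟨hn, hle⟩
    exact ⟨hn.1, fun i =>
      (Finset.single_le_sum (fun j _ => hn.1 j) (Finset.mem_univ i)).trans hle⟩
  obtain ⟨n, hnS, hmin⟩ := hS.exists_isMinOn ⟨n₀, hn₀, le_refl (∑ i, n₀ i)⟩
    (f := fun n : Fin L → ℝ => ∑ i, n i) (by fun_prop)
  have hleast : IsLeast (feasibleTotals f μ k δ) (ENNReal.ofReal (∑ i, n i)) := by
    refine ⟨⟨n, hnS.1, rfl⟩, ?_⟩
    rintro - ⟨n', hn', rfl⟩
    refine ENNReal.ofReal_le_ofReal ?_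
    rcases le_total (∑ i, n' i) (∑ i, n₀ i) with hle | hle
    · exact hmin ⟨hn', hle⟩
    · exact hnS.2.trans hle
  rw [tauStar, hleast.isGLB.sInf_eq]
  exact hleast

theorem tauStar_le_lintegral_T {L K : ℕ} [NeZero L] {f : (Fin L → ℝ) → (Fin K → ℝ)} {δ : ℝ}
    (hδ : 0 < δ) {A : Learner L K} (hA : Admissible f δ A) {μ : Fin L → ℝ} {k : Fin K}
    (hk : IsUniqueBest f μ k)
    (hf : significantDepartures f μ k ⊆ closure (changesBestArm f μ k)) :
    tauStar f μ k δ ≤ ∫⁻ ω, (A.T ω : ℝ≥0∞) ∂(A.law μ) := by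
  have hle : ∑ i, A.expectedQueries μ i ≤ _ := A.sum_tsum_queryProb_le μ
  refine le_trans ?_ hle
  by_cases hfin : ∀ i, A.expectedQueries μ i ≠ ⊤
  · refine sInf_le ⟨_, expectedQueries_mem_feasible hδ hA hk hf hfin, ?_⟩
    rw [ENNReal.ofReal_sum_of_nonneg fun i _ => ENNReal.toReal_nonneg]
    exact Finset.sum_congr rfl fun i _ => (ENNReal.ofReal_toReal (hfin i)).symm
  -- An infinite expected count already makes the sum infinite.
  · push Not at hfin
    obtain ⟨i, hi⟩ := hfin
    rw [ENNReal.sum_eq_top.2 ⟨i, Finset.mem_univ i, hi⟩]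
    exact le_top

end StructuredBAI

theorem theorem1 {L K : ℕ} [NeZero L] (f : (Fin L → ℝ) → (Fin K → ℝ)) (δ : ℝ) (hδ₀ : 0 < δ)
    (hδ₁ : δ < 1) (A : Learner L K) (hA : Admissible f δ A) (μ : Fin L → ℝ) (k : Fin K)
    (hk : IsUniqueBest f μ k)
    (hf : significantDepartures f μ k ⊆ closure (changesBestArm f μ k)) :
    ((feasibleTotals f μ k δ).Nonempty → IsLeast (feasibleTotals f μ k δ) (tauStar f μ k δ)) ∧
      tauStar f μ k δ ≤ ∫⁻ ω, (A.T ω : ℝ≥0∞) ∂(A.law μ) :=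
  ⟨isLeast_tauStar, tauStar_le_lintegral_T hδ₀ hA hk hf⟩
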